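/- Let $(G,\mathfrak g)$ be a complex Harish-Chandra superpair: $G$ is a complex Lie group, $\mathfrak g=\mathfrak g_0\oplus\mathfrak g_1$ is a finite-dimensional complex Lie superalgebra with $\mathfrak g_0=\mathrm{Lie}(G)$, and $Ad$ is a holomorphic action of $G$ on $\mathfrak g$ by (even) automorphisms of Lie superalgebras that extends the adjoint action on $\mathfrak g_0$ and whose differential at $e$ is the bracket with $\mathfrak g_0$. Let $E(\mathfrak g)$ be the enveloping superalgebra, on which $Ad$ acts by automorphisms, and let $\mathbf A^\ast_{\mathcal G}=\mathbb C(G)\# E(\mathfrak g)$ be the Lie-Hopf superalgebra, with multiplication $m_*$, $(g\#X)(h\#Y)=gh\#Ad(h^{-1})(X)\,Y$, comultiplication $\Delta$ (each $g\in G$ group-like, each $X\in\mathfrak g$ primitive) and antipode $s_*(g\#X)=g^{-1}\#Ad(g)(s(X))$, where $s$ is the antipode of $E(\mathfrak g)$. Let $\mathcal G$ be the complex Lie supergroup of $(G,\mathfrak g)$: its superfunctions on an open set $U\subset G$ are the linear forms $\Phi$ on $\mathbb C(U)\#E(\mathfrak g)$ such that $g\mapsto\Phi(g\#Z)$ is holomorphic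 on $U$ for all $Z\in E(\mathfrak g)$. Likewise, the superfunctions of $\mathcal G\times\mathcal G$ on an open set $W\subset G\times G$ are the linear forms on the span of the $(a\#X)\otimes(b\#Y)$, $(a,b)\in W$, $X,Y\in E(\mathfrak g)$, that depend holomorphically on $(a,b)\in W$ for fixed $X,Y$. Conjugation $\psi^{\centerdot}=(\psi,\psi^\#):\mathcal G\times\mathcal G\to\mathcal G$ of the first argument by the second one is the morphism whose push-forward of distributions is $$\psi^\#_*=m_*\circ(m_*\otimes s_*)\circ(T\otimes \mathrm{Id})\circ(\mathrm{Id}\otimes\Delta),$$ where $T(u\otimes v)=(-1)^{|u||v|}v\otimes u$ for homogeneous $u,v$. Then the underlying map is $\psi(a,b)=bab^{-1}$; the pull-back $\psi^\#\Phi=\Phi\circ\psi^\#_*$ maps superfunctions of $\mathcal G$ on any open $U\subset G$ to superfunctions of $\mathcal G\times\mathcal G$ on $\psi^{-1}(U)$; and $\psi^\#_*$ is given, for all $a,b\in G$ and all homogeneous $X_a\in E(\mathfrak g)$ and homogeneous $X_b\in\mathfrak g$, by $$\psi^\#_*(a\#X_a,b\#X_b)=\psi(a,b)\#Ad(b)\big((-1)^{|X_a||X_b|}Ad(a^{-1})(X_b)X_a-X_aX_b\big).$$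 Furthermore, for all $a,b\in G$, $X_a\in E(\mathfrak g)$ and $X_b\in\mathfrak g$, $$\psi^\#_*(a\#X_a,b\#\mathbf 1)=\psi(a,b)\#Ad(b)(X_a),$$ $$\psi^\#_*(a\#\mathbf 1,b\#X_b)=\psi(a,b)\#Ad(b)\big(Ad(a^{-1})(X_b)-X_b\big),$$ $$\psi^\#_*(a\#\mathbf 1,b\#\mathbf 1)=\psi(a,b)\#\mathbf 1 .$$ -/

import Mathlib

open scoped Manifold ContDiff TensorProduct
open TopologicalSpace (Opens)

noncomputable section

theorem zmod_two_cases (i : ZMod 2) : i = 0 ∨ i = 1 := by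
  revert i; decide

/-! ### Lie superalgebras and their enveloping superalgebras -/

/-- A complex Lie superalgebra: a `ℤ/2`-graded complex vector space with an even bilinear bracket
which is super skew-symmetric and satisfies the super Jacobi identity. -/
class LieSuperalgebra (L : Type*) [AddCommGroup L] [Module ℂ L] where
  grade : ZMod 2 → Submodule ℂ L
  isInternal : DirectSum.IsInternal grade
  bracket : L →ₗ[ℂ] L →ₗ[ℂ] L
  bracket_mem : ∀ {i j : ZMod 2} {x y : L}, x ∈ grade i → y ∈ grade j →
    bracket x y ∈ grade (i + j)
  bracket_skew : ∀ {i j : ZMod 2} {x y : L}, x ∈ grade i → y ∈ grade j →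
    bracket x y = -((-1 : ℤˣ) ^ (i * j) • bracket y x)
  jacobi : ∀ {i j : ZMod 2} {x y : L}, x ∈ grade i → y ∈ grade j → ∀ z : L,
    bracket x (bracket y z) =
      bracket (bracket x y) z + (-1 : ℤˣ) ^ (i * j) • bracket y (bracket x z)

namespace LieSuperalgebra

variable (L : Type*) [AddCommGroup L] [Module ℂ L] [LieSuperalgebra L]

/-- The relations `x y = (-1)^{|x||y|} y x + [x,y]` for homogeneous `x, y`. -/
inductive EnvRel : TensorAlgebra ℂ L → TensorAlgebra ℂ L → Prop
  | of {i j : ZMod 2} {x y : L} (hx : x ∈ grade (L := L) i) (hy : y ∈ grade (L := L) j) :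
      EnvRel (TensorAlgebra.ι ℂ x * TensorAlgebra.ι ℂ y)
        ((-1 : ℤˣ) ^ (i * j) • (TensorAlgebra.ι ℂ y * TensorAlgebra.ι ℂ x)
          + TensorAlgebra.ι ℂ (bracket x y))

/-- The universal enveloping superalgebra `E(L)`. -/
def Env : Type _ := RingQuot (EnvRel L)

instance : Ring (Env L) := inferInstanceAs (Ring (RingQuot (EnvRel L)))
instance : Algebra ℂ (Env L) := inferInstanceAs (Algebra ℂ (RingQuot (EnvRel L)))

variable {L}

namespace Env

/-- The canonical map `L → E(L)`. -/
def ι : L →ₗ[ℂ] Env L :=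
  (RingQuot.mkAlgHom ℂ (EnvRel L)).toLinearMap ∘ₗ TensorAlgebra.ι ℂ

theorem ι_mul_ι {i j : ZMod 2} {x y : L} (hx : x ∈ grade (L := L) i)
    (hy : y ∈ grade (L := L) j) :
    ι x * ι y = (-1 : ℤˣ) ^ (i * j) • (ι y * ι x) + ι (bracket x y) := by
  have h := RingQuot.mkAlgHom_rel ℂ (EnvRel.of hx hy)
  rw [map_add, Units.smul_def, map_zsmul, map_mul, map_mul, ← Units.smul_def] at h
  exact h

/-- The condition under which a linear map `f : L → A` extends to `E(L)`. -/
def Compatible {A : Type*} [Ring A] [Algebra ℂ A] (f : L →ₗ[ℂ] A) : Prop :=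
  ∀ ⦃i j : ZMod 2⦄ ⦃x y : L⦄, x ∈ grade (L := L) i → y ∈ grade (L := L) j →
    f x * f y = (-1 : ℤˣ) ^ (i * j) • (f y * f x) + f (bracket x y)

/-- The universal property of `E(L)`. -/
def lift {A : Type*} [Ring A] [Algebra ℂ A] (f : L →ₗ[ℂ] A) (hf : Compatible f) :
    Env L →ₐ[ℂ] A :=
  RingQuot.liftAlgHom ℂ ⟨TensorAlgebra.lift ℂ f, by
    rintro _ _ ⟨hx, hy⟩
    rw [map_add, Units.smul_def, map_zsmul, map_mul, map_mul, ← Units.smul_def]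
    simpa using hf hx hy⟩

@[simp]
theorem lift_ι {A : Type*} [Ring A] [Algebra ℂ A] (f : L →ₗ[ℂ] A) (hf : Compatible f) (x : L) :
    lift f hf (ι x) = f x := by
  have := RingQuot.liftAlgHom_mkAlgHom_apply ℂ (TensorAlgebra.lift ℂ f)
    (s := EnvRel L) (by
      rintro _ _ ⟨hx, hy⟩
      rw [map_add, Units.smul_def, map_zsmul, map_mul, map_mul, ← Units.smul_def]
      simpa using hf hx hy) (TensorAlgebra.ι ℂ x)
  exact this.trans (by simp)

theorem algHom_ext {A : Type*} [Ring A] [Algebra ℂ A] {f g : Env L →ₐ[ℂ] A}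
    (h : ∀ x, f (ι x) = g (ι x)) : f = g := by
  apply RingQuot.ringQuot_ext' ℂ
  apply TensorAlgebra.hom_ext
  ext x
  exact h x

end Env

/-- The projection of `L` onto its component of degree `i`. -/
def proj (i : ZMod 2) : L →ₗ[ℂ] L :=
  letI := (isInternal (L := L)).chooseDecomposition
  (grade (L := L) i).subtype ∘ₗ DirectSum.component ℂ (ZMod 2) (fun i => grade (L := L) i) i ∘ₗ
    (DirectSum.decomposeLinearEquiv (grade (L := L))).toLinearMap

theorem proj_of_mem {i : ZMod 2} {x : L} (hx : x ∈ grade (L := L) i) (j : ZMod 2) :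
    proj j x = if j = i then x else 0 := by
  let := (isInternal (L := L)).chooseDecomposition
  change ((DirectSum.decompose (grade (L := L)) x) j : L) = _
  rw [DirectSum.decompose_of_mem _ hx]
  split_ifs with h
  · subst h; simp
  · rw [DirectSum.of_eq_of_ne _ _ _ h]; rfl

/-- Induction over homogeneous elements. -/
theorem homogeneous_induction {p : L → Prop} (x : L)
    (mem : ∀ (i : ZMod 2) (y : L), y ∈ grade (L := L) i → p y) (zero : p 0)
    (add : ∀ y z, p y → p z → p (y + z)) : p x :=
  Submodule.iSup_induction (grade (L := L)) (motive := p) (x := x)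
    (by rw [(isInternal (L := L)).submodule_iSup_eq_top]; trivial) mem zero (fun y z => add y z)

theorem proj_zero_add_proj_one (x : L) : proj 0 x + proj 1 x = x := by
  induction x using homogeneous_induction with
  | mem i y hy =>
    rw [proj_of_mem hy, proj_of_mem hy]
    rcases zmod_two_cases i with rfl | rfl <;> simp
  | zero => simp
  | add y z hy hz =>
    rw [map_add, map_add, add_add_add_comm, hy, hz]

/-- The parity involution of `L`: the identity on even elements, minus the identity on odd ones. -/
def sgn : L →ₗ[ℂ] L := proj 0 - proj 1

theorem sgn_of_mem {i : ZMod 2} {x : L} (hx : x ∈ grade (L := L) i) :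
    sgn x = (-1 : ℤˣ) ^ i • x := by
  rw [sgn, LinearMap.sub_apply, proj_of_mem hx, proj_of_mem hx]
  rcases zmod_two_cases i with rfl | rfl <;> simp

namespace Env

/-- The parity automorphism of `E(L)`, extending that of `L`. -/
def parity : Env L →ₐ[ℂ] Env L :=
  lift (ι ∘ₗ sgn) (by
    intro i j x y hx hy
    simp only [LinearMap.comp_apply, sgn_of_mem hx, sgn_of_mem hy, sgn_of_mem (bracket_mem hx hy),
      Units.smul_def, map_zsmul]
    have h := ι_mul_ι hx hy
    simp only [Units.smul_def] at h
    rw [smul_mul_smul_comm, smul_mul_smul_comm, h]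
    rcases zmod_two_cases i with rfl | rfl <;> rcases zmod_two_cases j with rfl | rfl <;>
      simp [uzpow_add, smul_add])

@[simp]
theorem parity_ι (x : L) : parity (ι x) = ι (sgn x) :=
  lift_ι (ι ∘ₗ sgn) _ x

theorem parity_parity (x : Env L) : parity (parity x) = x := by
  have : (parity (L := L)).comp parity = AlgHom.id ℂ _ := by
    apply algHom_ext
    intro x
    induction x using homogeneous_induction with
    | mem i y hy =>
      simp only [AlgHom.comp_apply, parity_ι, AlgHom.id_apply, sgn_of_mem hy, Units.smul_def,
        map_zsmul, smul_smul]
      rcases zmod_two_cases i with rfl | rfl <;> simp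
    | zero => simp
    | add y z hy hz => rw [map_add, map_add, map_add, hy, hz]
  exact DFunLike.congr_fun this x

/-- The `ℤ/2`-grading of `E(L)` induced by that of `L`: the product of homogeneous
`x₁, …, xₙ ∈ L` has degree `|x₁| + ⋯ + |xₙ|`; equivalently, the component of degree `i` is the
`(-1)^i`-eigenspace of the parity automorphism. -/
def deg (i : ZMod 2) : Submodule ℂ (Env L) where
  carrier := {x | parity x = (-1 : ℤˣ) ^ i • x}
  zero_mem' := by simp
  add_mem' := by
    intro a b ha hb
    simp only [Set.mem_ofPred_eq] at *
    rw [map_add, ha, hb, smul_add]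
  smul_mem' := by
    intro c x hx
    simp only [Set.mem_ofPred_eq] at *
    rw [map_smul, hx, smul_comm]

theorem mem_deg {i : ZMod 2} {x : Env L} : x ∈ deg i ↔ parity x = (-1 : ℤˣ) ^ i • x := Iff.rfl

theorem ι_mem {i : ZMod 2} {x : L} (hx : x ∈ grade (L := L) i) : ι x ∈ deg (L := L) i := by
  rw [mem_deg, parity_ι, sgn_of_mem hx, Units.smul_def, map_zsmul, Units.smul_def]

/-- The projection of `E(L)` onto its component of degree `i`. -/
def projDeg (i : ZMod 2) : Env L →ₗ[ℂ] Env L :=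
  (2⁻¹ : ℂ) • (LinearMap.id + (-1 : ℤˣ) ^ i • parity.toLinearMap)

theorem projDeg_mem (i : ZMod 2) (x : Env L) : projDeg i x ∈ deg i := by
  rw [mem_deg]
  rcases zmod_two_cases i with rfl | rfl
  · simp [projDeg, parity_parity, add_comm]
  · simp [projDeg, parity_parity, ← smul_neg, add_comm]

theorem projDeg_of_mem {i : ZMod 2} {x : Env L} (hx : x ∈ deg i) (j : ZMod 2) :
    projDeg j x = if j = i then x else 0 := by
  rw [mem_deg] at hx
  rcases zmod_two_cases i with rfl | rfl <;> rcases zmod_two_cases j with rfl | rfl <;>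
    simp [projDeg, hx] <;> module

theorem projDeg_sum (x : Env L) : projDeg 0 x + projDeg 1 x = x := by
  simp only [projDeg, LinearMap.smul_apply, LinearMap.add_apply, LinearMap.id_apply, uzpow_zero,
    uzpow_one, one_smul, Units.neg_smul, LinearMap.neg_apply]
  module

instance : SetLike.GradedMonoid (deg (L := L)) where
  one_mem := by simp [mem_deg]
  mul_mem := by
    intro i j x y hx hy
    rw [mem_deg] at *
    rw [map_mul, hx, hy, uzpow_add, Units.smul_def, Units.smul_def, Units.smul_def,
      smul_mul_smul_comm, Units.val_mul]

/-- The projection of `E(L)` onto its component of degree `i`, with values in that component. -/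
def toDeg (i : ZMod 2) : Env L →ₗ[ℂ] deg (L := L) i :=
  (projDeg i).codRestrict (deg i) (projDeg_mem i)

instance : DirectSum.Decomposition (deg (L := L)) :=
  DirectSum.Decomposition.ofLinearMap _
    (DirectSum.lof ℂ (ZMod 2) (fun i => deg (L := L) i) 0 ∘ₗ toDeg 0 +
      DirectSum.lof ℂ (ZMod 2) (fun i => deg (L := L) i) 1 ∘ₗ toDeg 1)
    (by
      ext x
      simp [toDeg, projDeg_sum])
    (by
      ext i x : 2
      have h : ∀ j, toDeg j (x : Env L) = if h : i = j then h ▸ x else 0 := by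
        intro j
        split_ifs with h
        · subst h
          exact Subtype.ext ((projDeg_of_mem x.2 i).trans (if_pos rfl))
        · exact Subtype.ext ((projDeg_of_mem x.2 j).trans (if_neg (Ne.symm h)))
      rcases zmod_two_cases i with rfl | rfl <;> simp [h])

instance : GradedAlgebra (deg (L := L)) where

theorem compatible_add {A : Type*} [Ring A] [Algebra ℂ A] (l r : Env L →ₐ[ℂ] A)
    (h : ∀ ⦃i j : ZMod 2⦄ ⦃a b : Env L⦄, a ∈ deg (L := L) i → b ∈ deg (L := L) j →
      r a * l b = (-1 : ℤˣ) ^ (i * j) • (l b * r a)) :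
    Compatible (l.toLinearMap ∘ₗ ι + r.toLinearMap ∘ₗ ι) := by
  intro i j x y hx hy
  have h1 := h (ι_mem hx) (ι_mem hy)
  have h2 := h (ι_mem hy) (ι_mem hx)
  have h3 := ι_mul_ι hx hy
  have h4 := congrArg l h3
  have h5 := congrArg r h3
  simp only [LinearMap.add_apply, LinearMap.comp_apply, AlgHom.toLinearMap_apply]
  simp only [map_mul, map_add, Units.smul_def, map_zsmul] at h1 h2 h4 h5 ⊢
  rw [add_mul, mul_add, mul_add, add_mul, mul_add, mul_add, h4, h5, h1, h2]
  rcases zmod_two_cases i with rfl | rfl <;> rcases zmod_two_cases j with rfl | rfl <;>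
    simp <;> abel

/-- The comultiplication of `E(L)`: the morphism of superalgebras from `E(L)` to the graded tensor
product of `E(L)` with itself with `X ↦ X ⊗ 1 + 1 ⊗ X` for `X ∈ L`. -/
def comulAlgHom : Env L →ₐ[ℂ] (deg (L := L) ᵍ⊗[ℂ] deg (L := L)) :=
  lift ((GradedTensorProduct.includeLeft (deg (L := L)) (deg (L := L))).toLinearMap ∘ₗ ι +
      (GradedTensorProduct.includeRight (deg (L := L)) (deg (L := L))).toLinearMap ∘ₗ ι)
    (compatible_add _ _ (by
      intro i j a b ha hb
      have h := GradedTensorProduct.tmul_coe_mul_coe_tmul (R := ℂ) (deg (L := L)) (deg (L := L))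
        1 ⟨a, ha⟩ ⟨b, hb⟩ 1
      rw [one_mul, mul_one] at h
      rw [GradedTensorProduct.includeRight_apply, GradedTensorProduct.includeLeft_apply,
        GradedTensorProduct.tmul_one_mul_one_tmul]
      exact h))

/-- The comultiplication of `E(L)` as a linear map to `E(L) ⊗ E(L)`. -/
def comul : Env L →ₗ[ℂ] Env L ⊗[ℂ] Env L :=
  (GradedTensorProduct.of ℂ (deg (L := L)) (deg (L := L))).symm.toLinearMap ∘ₗ
    comulAlgHom.toLinearMap

theorem comul_one : comul (1 : Env L) = 1 ⊗ₜ 1 := by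
  simp only [comul, LinearMap.comp_apply, AlgHom.toLinearMap_apply, map_one]
  rfl

theorem comul_ι (X : L) : comul (ι X) = ι X ⊗ₜ 1 + 1 ⊗ₜ[ℂ] ι X := by
  simp only [comul, LinearMap.comp_apply, AlgHom.toLinearMap_apply, comulAlgHom, lift_ι]
  rfl

/-- The super flip `x ⊗ y ↦ (-1)^{|x||y|} y ⊗ x`. -/
def flip : Env L ⊗[ℂ] Env L →ₗ[ℂ] Env L ⊗[ℂ] Env L :=
  (GradedTensorProduct.of ℂ (deg (L := L)) (deg (L := L))).symm.toLinearMap ∘ₗ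
    (GradedTensorProduct.comm (deg (L := L)) (deg (L := L))).toLinearMap ∘ₗ
      (GradedTensorProduct.of ℂ (deg (L := L)) (deg (L := L))).toLinearMap

theorem flip_tmul {i j : ZMod 2} {x y : Env L} (hx : x ∈ deg (L := L) i)
    (hy : y ∈ deg (L := L) j) : flip (x ⊗ₜ y) = (-1 : ℤˣ) ^ (i * j) • (y ⊗ₜ[ℂ] x) := by
  have h := GradedTensorProduct.comm_coe_tmul_coe (R := ℂ) (deg (L := L)) (deg (L := L))
    ⟨x, hx⟩ ⟨y, hy⟩
  rw [mul_comm]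
  exact h

/-- The right super-multiplication `X ↦ (u ↦ -(-1)^{|X||u|} u X)`, for `X ∈ L`, `u ∈ E(L)`. -/
def rightAct : L →ₗ[ℂ] Module.End ℂ (Env L) :=
  LinearMap.mk₂ ℂ (fun X u => -(u * ι (proj 0 X) + parity u * ι (proj 1 X)))
    (by intro a b u; simp only [map_add, mul_add]; abel)
    (by intro c a u; simp only [map_smul, mul_smul_comm, ← smul_add, smul_neg])
    (by intro a u v; simp only [map_add, add_mul]; abel)
    (by intro c a u; simp only [map_smul, smul_mul_assoc, ← smul_add, smul_neg])

theorem rightAct_even {X : L} (hX : X ∈ grade (L := L) 0) (u : Env L) :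
    rightAct X u = -(u * ι X) := by
  simp [rightAct, proj_of_mem hX]

theorem rightAct_odd {X : L} (hX : X ∈ grade (L := L) 1) (u : Env L) :
    rightAct X u = -(parity u * ι X) := by
  simp [rightAct, proj_of_mem hX]

theorem rightAct_apply {i j : ZMod 2} {X : L} (hX : X ∈ grade (L := L) i) {u : Env L}
    (hu : u ∈ deg (L := L) j) : rightAct X u = -((-1 : ℤˣ) ^ (i * j) • (u * ι X)) := by
  rw [mem_deg] at hu
  rcases zmod_two_cases i with rfl | rfl
  · simp [rightAct_even hX]
  · simp [rightAct_odd hX, hu, Units.smul_def, mul_assoc]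

theorem rightAct_compatible : Compatible (rightAct (L := L)) := by
  intro i j x y hx hy
  have h := ι_mul_ι hx hy
  have hb := bracket_mem hx hy
  ext u
  rw [Module.End.mul_apply, LinearMap.add_apply, Units.smul_def, LinearMap.smul_apply,
    Module.End.mul_apply]
  rcases zmod_two_cases i with rfl | rfl <;> rcases zmod_two_cases j with rfl | rfl
  · have hb' : bracket x y ∈ grade (L := L) 0 := hb
    simp only [rightAct_even hx, rightAct_even hy, rightAct_even hb']
    have := congrArg (u * ·) h
    simp [mul_add, mul_assoc] at this ⊢
    rw [this]; abel
  · have hb' : bracket x y ∈ grade (L := L) 1 := hb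
    simp only [rightAct_even hx, rightAct_odd hy, rightAct_odd hb']
    have := congrArg (parity u * ·) h
    simp [mul_add, mul_assoc, sgn_of_mem hx] at this ⊢
    rw [this]; abel
  · have hb' : bracket x y ∈ grade (L := L) 1 := hb
    simp only [rightAct_odd hx, rightAct_even hy, rightAct_odd hb']
    have := congrArg (parity u * ·) h
    simp [mul_add, mul_assoc, sgn_of_mem hy] at this ⊢
    rw [this]; abel
  · have hb' : bracket x y ∈ grade (L := L) 0 := hb
    simp only [rightAct_odd hx, rightAct_odd hy, rightAct_even hb']
    have := congrArg (u * ·) h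
    simp [mul_add, mul_assoc, sgn_of_mem hy, sgn_of_mem hx, parity_parity] at this ⊢
    rw [this]; abel

/-- The antipode of `E(L)`: the linear map with `s(1) = 1`, `s(X) = -X` for `X ∈ L` and
`s(xy) = (-1)^{|x||y|} s(y) s(x)` for homogeneous `x, y`. -/
def antipode : Env L →ₗ[ℂ] Env L :=
  LinearMap.applyₗ (1 : Env L) ∘ₗ (lift rightAct rightAct_compatible).toLinearMap

theorem antipode_one : antipode (1 : Env L) = 1 := by
  simp [antipode]

theorem antipode_ι_mul (X : L) (y : Env L) :
    antipode (ι X * y) = rightAct X (antipode y) := by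
  simp [antipode]

end Env

end LieSuperalgebra

/-! ### Superspaces given by their distributions, and their morphisms

A supermanifold with underlying manifold `X` all of whose spaces of distributions supported at a
point are identified with one super vector space `V` is described by the distributions `x # Z`
(`x ∈ X`, `Z ∈ V`), which span `X →₀ V = ℂ(X) ⊗ V`. -/

/-- A morphism described on distributions: a continuous map `X → Y` of the underlying spaces and,
for every `x`, a linear map from the distributions at `x` to the distributions at the image of
`x`. -/
structure SuperMap (X V Y W : Type*) [TopologicalSpace X] [TopologicalSpace Y]
    [AddCommGroup V] [Module ℂ V] [AddCommGroup W] [Module ℂ W] where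
  base : C(X, Y)
  fibre : X → V →ₗ[ℂ] W

namespace SuperMap

variable {X V Y W X' V' Y' W' : Type*} [TopologicalSpace X] [TopologicalSpace Y]
  [AddCommGroup V] [Module ℂ V] [AddCommGroup W] [Module ℂ W]
  [TopologicalSpace X'] [TopologicalSpace Y']
  [AddCommGroup V'] [Module ℂ V'] [AddCommGroup W'] [Module ℂ W']

/-- The push-forward of distributions, `x # Z ↦ f(x) # f_x(Z)`. -/
def push (f : SuperMap X V Y W) : (X →₀ V) →ₗ[ℂ] (Y →₀ W) :=
  Finsupp.lsum ℂ fun x => Finsupp.lsingle (f.base x) ∘ₗ f.fibre x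

/-- The push-forward of distributions on `f⁻¹(U)` to distributions on `U`. -/
def pushOn (f : SuperMap X V Y W) (U : Opens Y) :
    (Opens.comap f.base U →₀ V) →ₗ[ℂ] (U →₀ W) :=
  Finsupp.lsum ℂ fun x => Finsupp.lsingle (⟨f.base x, x.2⟩ : U) ∘ₗ f.fibre x

/-- The pull-back of linear forms on the distributions on `U` to linear forms on the distributions
on `f⁻¹(U)`: the transpose of the push-forward. -/
def pullback (f : SuperMap X V Y W) (U : Opens Y) :
    ((U →₀ W) →ₗ[ℂ] ℂ) →ₗ[ℂ] ((Opens.comap f.base U →₀ V) →ₗ[ℂ] ℂ) :=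
  (f.pushOn U).lcomp ℂ ℂ

/-- Composition of morphisms. -/
def comp (g : SuperMap Y W X' V') (f : SuperMap X V Y W) : SuperMap X V X' V' where
  base := g.base.comp f.base
  fibre x := g.fibre (f.base x) ∘ₗ f.fibre x

/-- The identity morphism. -/
def id (X V : Type*) [TopologicalSpace X] [AddCommGroup V] [Module ℂ V] : SuperMap X V X V where
  base := ContinuousMap.id X
  fibre _ := LinearMap.id

/-- The product of two (even) morphisms; the distributions at a point of a product are the tensor
products of the distributions on the factors. -/
def prod (f : SuperMap X V Y W) (g : SuperMap X' V' Y' W') :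
    SuperMap (X × X') (V ⊗[ℂ] V') (Y × Y') (W ⊗[ℂ] W') where
  base := f.base.prodMap g.base
  fibre x := TensorProduct.map (f.fibre x.1) (g.fibre x.2)

/-- The canonical isomorphism `A × (B × C) → (A × B) × C`. -/
def assocSymm (X V Y W X' V' : Type*) [TopologicalSpace X] [TopologicalSpace Y]
    [TopologicalSpace X'] [AddCommGroup V] [Module ℂ V] [AddCommGroup W] [Module ℂ W]
    [AddCommGroup V'] [Module ℂ V'] :
    SuperMap (X × (Y × X')) (V ⊗[ℂ] (W ⊗[ℂ] V')) ((X × Y) × X') ((V ⊗[ℂ] W) ⊗[ℂ] V') where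
  base := ⟨fun p => ((p.1, p.2.1), p.2.2), by fun_prop⟩
  fibre _ := (TensorProduct.assoc ℂ V W V').symm.toLinearMap

end SuperMap

/-- The holomorphic superfunctions on the open set `U`: the linear forms `Φ` on the distributions
on `U` such that `x ↦ Φ(x # Z)` is a holomorphic function on `U` for every `Z`. -/
def superfunctions {E' H X : Type*} [NormedAddCommGroup E'] [NormedSpace ℂ E']
    [TopologicalSpace H] (I : ModelWithCorners ℂ E' H) [TopologicalSpace X] [ChartedSpace H X]
    (V : Type*) [AddCommGroup V] [Module ℂ V] (U : Opens X) :
    Submodule ℂ ((U →₀ V) →ₗ[ℂ] ℂ) where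
  carrier := {Φ | ∀ Z : V, MDifferentiable I 𝓘(ℂ, ℂ) fun x : U => Φ (Finsupp.single x Z)}
  zero_mem' := fun _ => mdifferentiable_const
  add_mem' := fun ha hb Z => (ha Z).add (hb Z)
  smul_mem' := fun c _ ha Z => (ha Z).const_smul c

/-! ### Harish-Chandra superpairs and their Lie-Hopf superalgebras -/

open LieSuperalgebra

/-- A complex Harish-Chandra superpair `(G, L)`: a complex Lie group `G`, a Lie superalgebra `L`
whose even part is identified with the Lie algebra of `G`, and a holomorphic action `Ad` of `G` on
`L` by automorphisms of Lie superalgebras which extends the adjoint action of `G` on its Lie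
algebra and whose differential at `1` is the bracket with the even part. -/
structure HarishChandraSuperpair (F G L : Type*) [NormedAddCommGroup F] [NormedSpace ℂ F]
    [TopologicalSpace G] [ChartedSpace F G] [Group G] [LieGroup 𝓘(ℂ, F) ω G]
    [AddCommGroup L] [Module ℂ L] [LieSuperalgebra L] where
  /-- the identification of the even part of `L` with the Lie algebra of `G` -/
  lieEquiv : grade (L := L) 0 ≃ₗ[ℂ] GroupLieAlgebra 𝓘(ℂ, F) G
  lieEquiv_bracket : ∀ X Y Z : grade (L := L) 0, (Z : L) = bracket (X : L) (Y : L) →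
    lieEquiv Z = ⁅lieEquiv X, lieEquiv Y⁆
  /-- the integrated adjoint representation -/
  Ad : G →* Module.End ℂ L
  Ad_mem : ∀ (g : G) {i : ZMod 2} {X : L}, X ∈ grade (L := L) i → Ad g X ∈ grade (L := L) i
  Ad_bracket : ∀ (g : G) (X Y : L), Ad g (bracket X Y) = bracket (Ad g X) (Ad g Y)
  Ad_holomorphic : ∀ (f : L →ₗ[ℂ] ℂ) (Y : L),
    MDifferentiable 𝓘(ℂ, F) 𝓘(ℂ, ℂ) fun g : G => f (Ad g Y)
  Ad_even : ∀ (g : G) (X Y : grade (L := L) 0), (Y : L) = Ad g X →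
    (lieEquiv Y : F) = mfderiv 𝓘(ℂ, F) 𝓘(ℂ, F) (fun h : G => g * h * g⁻¹) 1 (lieEquiv X)
  mfderiv_Ad : ∀ (f : L →ₗ[ℂ] ℂ) (X : grade (L := L) 0) (Y : L),
    (mfderiv 𝓘(ℂ, F) 𝓘(ℂ, ℂ) (fun g : G => f (Ad g Y)) 1 (lieEquiv X) : ℂ) =
      f (bracket (X : L) Y)

namespace HarishChandraSuperpair

variable {F G L : Type*} [NormedAddCommGroup F] [NormedSpace ℂ F]
  [TopologicalSpace G] [ChartedSpace F G] [Group G] [LieGroup 𝓘(ℂ, F) ω G]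
  [AddCommGroup L] [Module ℂ L] [LieSuperalgebra L]

/-- The extension of `Ad g` to an automorphism of the superalgebra `E(L)`. -/
def envAd (P : HarishChandraSuperpair F G L) (g : G) : Env L →ₐ[ℂ] Env L :=
  Env.lift (Env.ι ∘ₗ P.Ad g) (by
    intro i j x y hx hy
    simp only [LinearMap.comp_apply, P.Ad_bracket]
    exact Env.ι_mul_ι (P.Ad_mem g hx) (P.Ad_mem g hy))

/-! The Lie-Hopf superalgebra `ℂ(G) # E(L)` is `G →₀ Env L`, with `g # X` written as
`Finsupp.single g X`, and `(ℂ(G) # E(L)) ⊗ (ℂ(G) # E(L))` is `G × G →₀ Env L ⊗ Env L`, with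
`(a # X) ⊗ (b # Y)` written as `Finsupp.single (a, b) (X ⊗ₜ Y)`. -/

/-- Multiplication, `(g # X) ⊗ (h # Y) ↦ gh # Ad(h⁻¹)(X) Y`. -/
def mulMap (P : HarishChandraSuperpair F G L) :
    SuperMap (G × G) (Env L ⊗[ℂ] Env L) G (Env L) where
  base := ⟨fun p => p.1 * p.2,
    (topologicalGroup_of_lieGroup 𝓘(ℂ, F) ω (G := G)).toContinuousMul.continuous_mul⟩
  fibre p := LinearMap.mul' ℂ (Env L) ∘ₗ
    TensorProduct.map (P.envAd p.2⁻¹).toLinearMap LinearMap.id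

/-- Inverse, `g # X ↦ g⁻¹ # Ad(g)(s(X))`, where `s` is the antipode of `E(L)`. -/
def invMap (P : HarishChandraSuperpair F G L) : SuperMap G (Env L) G (Env L) where
  base := ⟨fun g => g⁻¹,
    (topologicalGroup_of_lieGroup 𝓘(ℂ, F) ω (G := G)).toContinuousInv.continuous_inv⟩
  fibre g := (P.envAd g).toLinearMap ∘ₗ Env.antipode

variable (G L) in
/-- The diagonal, inducing the comultiplication `g # X ↦ ∑ (g # X') ⊗ (g # X'')`. -/
def diagMap : SuperMap G (Env L) (G × G) (Env L ⊗[ℂ] Env L) where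
  base := ⟨fun g => (g, g), by fun_prop⟩
  fibre _ := Env.comul

variable (G L) in
/-- The flip, `(g # X) ⊗ (h # Y) ↦ (-1)^{|X||Y|} (h # Y) ⊗ (g # X)`. -/
def flipMap : SuperMap (G × G) (Env L ⊗[ℂ] Env L) (G × G) (Env L ⊗[ℂ] Env L) where
  base := ⟨Prod.swap, continuous_swap⟩
  fibre _ := Env.flip

/-- Conjugation of the first argument by the second one on the Lie supergroup of `(G, L)`:
`m ∘ (m × s) ∘ (T × id) ∘ (id × Δ)`. -/
def conjMap (P : HarishChandraSuperpair F G L) :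
    SuperMap (G × G) (Env L ⊗[ℂ] Env L) G (Env L) :=
  P.mulMap.comp <|
    (P.mulMap.prod P.invMap).comp <|
      ((flipMap G L).prod (SuperMap.id G (Env L))).comp <|
        (SuperMap.assocSymm G (Env L) G (Env L) G (Env L)).comp <|
          (SuperMap.id G (Env L)).prod (diagMap G L)

end HarishChandraSuperpair

end

/-!
The fibre of the conjugation morphism over `(a, b)` unfolds, on `Xₐ ⊗ Z` with
`Δ Z = ∑ Z' ⊗ Z''`, to `∑ ± Ad(b)(Ad(a⁻¹)(Z') Xₐ s(Z''))`, because the last multiplication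
twists by `Ad((b⁻¹)⁻¹) = Ad(b)` and the inverse already contributes `Ad(b)`. For `Z = 1` and
`Z = X_b ∈ L` the comultiplication and the antipode are explicit, and the formulas follow
(`HarishChandraSuperpair.conjMap_fibre_tmul_ι`, `HarishChandraSuperpair.conjMap_fibre_tmul_one`).

For the pull-back of superfunctions, `Φ` is only known to be holomorphic in the point for a *fixed*
element of `E(L)`, whereas the fibre of the conjugation at `(a, b)` moves with `(a, b)`. However it
moves inside a finite-dimensional subspace: `Ad(g)(u)` is a finite sum `∑ cₖ(g) wₖ` with
holomorphic `cₖ` and fixed `wₖ`, by finite-dimensionality of `L` when `u ∈ L`, and then for all `u`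
because such families are stable under sums and products. Families of this kind
(`holomorphicFamilies`) and the families of operators
that preserve them (`IsHolomorphicOperator`) are stable
under composition and tensor products, so the fibres of the conjugation form one
(`HarishChandraSuperpair.isHolomorphicOperator_conjMap`), and `Φ` is holomorphic along them by
linearity (`mdifferentiable_apply_single`).
-/

/-! ### Holomorphic families of vectors and of operators -/

section HolomorphicFamilies

variable {E' H : Type*} [NormedAddCommGroup E'] [NormedSpace ℂ E'] [TopologicalSpace H]
  {I : ModelWithCorners ℂ E' H} {M V V' W W' : Type*} [TopologicalSpace M] [ChartedSpace H M]
  [AddCommGroup V] [Module ℂ V] [AddCommGroup V'] [Module ℂ V']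
  [AddCommGroup W] [Module ℂ W] [AddCommGroup W'] [Module ℂ W']

variable (I M V) in
/-- The functions `M → V` which are finite sums `∑ cₖ(x) wₖ` with holomorphic coefficients `cₖ` and
constant vectors `wₖ`. No topology on `V` is involved. -/
def holomorphicFamilies : Submodule ℂ (M → V) :=
  Submodule.span ℂ {f | ∃ (c : M → ℂ) (w : V), MDifferentiable I 𝓘(ℂ, ℂ) c ∧ f = fun x => c x • w}

theorem smul_const_mem_holomorphicFamilies {c : M → ℂ} (hc : MDifferentiable I 𝓘(ℂ, ℂ) c) (w : V) :
    (fun x => c x • w) ∈ holomorphicFamilies I M V :=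
  Submodule.subset_span ⟨c, w, hc, rfl⟩

theorem const_mem_holomorphicFamilies (w : V) : (fun _ => w) ∈ holomorphicFamilies I M V := by
  simpa using smul_const_mem_holomorphicFamilies (I := I) (M := M)
    (mdifferentiable_const (c := (1 : ℂ))) w

theorem smul_mem_holomorphicFamilies {c : M → ℂ} (hc : MDifferentiable I 𝓘(ℂ, ℂ) c) {f : M → V}
    (hf : f ∈ holomorphicFamilies I M V) : (fun x => c x • f x) ∈ holomorphicFamilies I M V := by
  induction hf using Submodule.span_induction with
  | mem f hf =>
    obtain ⟨d, w, hd, rfl⟩ := hf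
    simp only [smul_smul]
    exact smul_const_mem_holomorphicFamilies (hc.mul hd) w
  | zero => simpa using const_mem_holomorphicFamilies 0
  | add f g _ _ hf hg => simpa [smul_add, Pi.add_def] using add_mem hf hg
  | smul r f _ hf => simpa [smul_comm _ r, Pi.smul_def] using Submodule.smul_mem _ r hf

variable (I) in
/-- A family of linear maps `V → W` parametrized by `M` whose value at each fixed vector is a
holomorphic family of vectors. -/
def IsHolomorphicOperator (T : M → V →ₗ[ℂ] W) : Prop :=
  ∀ v, (fun x => T x v) ∈ holomorphicFamilies I M W

namespace IsHolomorphicOperator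

theorem const (T : V →ₗ[ℂ] W) : IsHolomorphicOperator I fun _ : M => T :=
  fun v => const_mem_holomorphicFamilies (T v)

theorem apply {T : M → V →ₗ[ℂ] W} (hT : IsHolomorphicOperator I T) {f : M → V}
    (hf : f ∈ holomorphicFamilies I M V) : (fun x => T x (f x)) ∈ holomorphicFamilies I M W := by
  induction hf using Submodule.span_induction with
  | mem f hf =>
    obtain ⟨c, w, hc, rfl⟩ := hf
    simpa using smul_mem_holomorphicFamilies hc (hT w)
  | zero => simpa using const_mem_holomorphicFamilies 0
  | add f g _ _ hf hg => simpa [Pi.add_def] using add_mem hf hg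
  | smul r f _ hf => simpa [Pi.smul_def] using Submodule.smul_mem _ r hf

theorem comp {S : M → W →ₗ[ℂ] W'} {T : M → V →ₗ[ℂ] W} (hS : IsHolomorphicOperator I S)
    (hT : IsHolomorphicOperator I T) : IsHolomorphicOperator I fun x => S x ∘ₗ T x :=
  fun v => hS.apply (hT v)

end IsHolomorphicOperator

theorem bilin_mem_holomorphicFamilies (B : V →ₗ[ℂ] V' →ₗ[ℂ] W) {f : M → V} {g : M → V'}
    (hf : f ∈ holomorphicFamilies I M V) (hg : g ∈ holomorphicFamilies I M V') :
    (fun x => B (f x) (g x)) ∈ holomorphicFamilies I M W :=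
  IsHolomorphicOperator.apply (T := fun x => B.flip (g x))
    (fun v => (IsHolomorphicOperator.const (B v)).apply hg) hf

theorem IsHolomorphicOperator.tensorMap {S : M → V →ₗ[ℂ] W} {T : M → V' →ₗ[ℂ] W'}
    (hS : IsHolomorphicOperator I S) (hT : IsHolomorphicOperator I T) :
    IsHolomorphicOperator I fun x => TensorProduct.map (S x) (T x) := by
  intro z
  induction z with
  | zero => simpa using const_mem_holomorphicFamilies 0
  | tmul v w => exact bilin_mem_holomorphicFamilies (TensorProduct.mk ℂ W W') (hS v) (hT w)
  | add y z hy hz => simpa [Pi.add_def] using add_mem hy hz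

/-- A superfunction, evaluated along a holomorphic map of base points and a holomorphic family of
vectors, gives a holomorphic function. -/
theorem mdifferentiable_apply_single {E'' H' X : Type*} [NormedAddCommGroup E'']
    [NormedSpace ℂ E''] [TopologicalSpace H'] {J : ModelWithCorners ℂ E'' H'} [TopologicalSpace X]
    [ChartedSpace H' X] {U : Opens X} {Φ : (U →₀ V) →ₗ[ℂ] ℂ} (hΦ : Φ ∈ superfunctions J V U)
    {φ : M → U} (hφ : MDifferentiable I J φ) {f : M → V} (hf : f ∈ holomorphicFamilies I M V) :
    MDifferentiable I 𝓘(ℂ, ℂ) fun x => Φ (Finsupp.single (φ x) (f x)) := by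
  induction hf using Submodule.span_induction with
  | mem f hf =>
    obtain ⟨c, w, hc, rfl⟩ := hf
    simp only [← Finsupp.smul_single, map_smul]
    exact hc.mul ((hΦ w).comp hφ)
  | zero => simpa using mdifferentiable_const
  | add f g _ _ hf hg =>
    simp only [Pi.add_apply, Finsupp.single_add, map_add]
    exact hf.add hg
  | smul r f _ hf =>
    simp only [Pi.smul_apply, ← Finsupp.smul_single, map_smul]
    exact hf.const_smul r

end HolomorphicFamilies

/-! ### Conjugation on the Lie supergroup of a Harish-Chandra superpair -/

open LieSuperalgebra

namespace LieSuperalgebra.Env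

variable {L : Type*} [AddCommGroup L] [Module ℂ L] [LieSuperalgebra L]

theorem induction_on {p : Env L → Prop} (u : Env L)
    (algebraMap : ∀ c : ℂ, p (algebraMap ℂ (Env L) c)) (ι : ∀ X : L, p (ι X))
    (mul : ∀ u v, p u → p v → p (u * v)) (add : ∀ u v, p u → p v → p (u + v)) : p u := by
  obtain ⟨t, rfl⟩ := RingQuot.mkAlgHom_surjective ℂ (EnvRel L) u
  induction t using TensorAlgebra.induction with
  | algebraMap c => rw [AlgHom.commutes]; exact algebraMap c
  | ι X => exact ι X
  | mul s t hs ht => rw [map_mul]; exact mul _ _ hs ht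
  | add s t hs ht => rw [map_add]; exact add _ _ hs ht

theorem antipode_ι (X : L) : antipode (ι X) = -ι X := by
  have h := antipode_ι_mul X (1 : Env L)
  rw [mul_one, antipode_one] at h
  rw [h]
  simp only [rightAct, LinearMap.mk₂_apply, map_one, one_mul]
  rw [← map_add, proj_zero_add_proj_one]

theorem flip_tmul_one (u : Env L) : flip (u ⊗ₜ[ℂ] (1 : Env L)) = 1 ⊗ₜ u := by
  have one_mem : (1 : Env L) ∈ deg (L := L) 0 := SetLike.GradedOne.one_mem
  rw [← projDeg_sum u, TensorProduct.add_tmul, map_add,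
    flip_tmul (projDeg_mem 0 u) one_mem, flip_tmul (projDeg_mem 1 u) one_mem,
    TensorProduct.tmul_add]
  simp

end LieSuperalgebra.Env

namespace HarishChandraSuperpair

variable {F G L : Type*} [NormedAddCommGroup F] [NormedSpace ℂ F]
  [TopologicalSpace G] [ChartedSpace F G] [Group G] [LieGroup 𝓘(ℂ, F) ω G]
  [AddCommGroup L] [Module ℂ L] [LieSuperalgebra L] (P : HarishChandraSuperpair F G L)

theorem envAd_ι (g : G) (X : L) : P.envAd g (Env.ι X) = Env.ι (P.Ad g X) :=
  Env.lift_ι _ _ X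

theorem conjMap_fibre_apply (a b : G) (z : Env L ⊗[ℂ] Env L) :
    P.conjMap.fibre (a, b) z =
      (P.mulMap.fibre (b * a, b⁻¹)) (TensorProduct.map (P.mulMap.fibre (b, a)) (P.invMap.fibre b)
        (TensorProduct.map Env.flip LinearMap.id ((TensorProduct.assoc ℂ _ _ _).symm
          (TensorProduct.map LinearMap.id Env.comul z)))) :=
  rfl

theorem mulMap_fibre_tmul (g h : G) (u v : Env L) :
    P.mulMap.fibre (g, h) (u ⊗ₜ v) = P.envAd h⁻¹ u * v :=
  rfl

theorem invMap_fibre (g : G) (u : Env L) : P.invMap.fibre g u = P.envAd g (Env.antipode u) :=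
  rfl

theorem push_conjMap_single (a b : G) (z : Env L ⊗[ℂ] Env L) :
    P.conjMap.push (Finsupp.single (a, b) z) =
      Finsupp.single (b * a * b⁻¹) (P.conjMap.fibre (a, b) z) := by
  simp only [SuperMap.push, Finsupp.lsum_single]
  rfl

theorem conjMap_fibre_tmul_one (a b : G) (Xa : Env L) :
    P.conjMap.fibre (a, b) (Xa ⊗ₜ 1) = P.envAd b Xa := by
  rw [conjMap_fibre_apply]
  simp [Env.comul_one, Env.flip_tmul_one, mulMap_fibre_tmul, invMap_fibre, Env.antipode_one]

theorem conjMap_fibre_tmul_ι (a b : G) {i j : ZMod 2} {Xa : Env L} {Xb : L}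
    (ha : Xa ∈ Env.deg (L := L) i) (hb : Xb ∈ grade (L := L) j) :
    P.conjMap.fibre (a, b) (Xa ⊗ₜ Env.ι Xb) =
      P.envAd b ((-1 : ℤˣ) ^ (i * j) • (P.envAd a⁻¹ (Env.ι Xb) * Xa) - Xa * Env.ι Xb) := by
  rw [conjMap_fibre_apply]
  simp [Env.comul_ι, TensorProduct.tmul_add, Env.flip_tmul_one, Env.flip_tmul ha (Env.ι_mem hb),
    mulMap_fibre_tmul, invMap_fibre, Env.antipode_one, Env.antipode_ι, sub_eq_add_neg,
    Units.smul_def, -zsmul_eq_mul, TensorProduct.smul_tmul', map_zsmul]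

section Holomorphic

variable {E' H M : Type*} [NormedAddCommGroup E'] [NormedSpace ℂ E'] [TopologicalSpace H]
  {I : ModelWithCorners ℂ E' H} [TopologicalSpace M] [ChartedSpace H M]

/-- The coefficients are the coordinates of `Ad(γ(x))(X)` in a basis of `L` if `X ∈ L`; the general
case follows since `E(L)` is generated by `L`. -/
theorem isHolomorphicOperator_envAd [FiniteDimensional ℂ L] {γ : M → G}
    (hγ : MDifferentiable I 𝓘(ℂ, F) γ) :
    IsHolomorphicOperator I fun x => (P.envAd (γ x)).toLinearMap := by
  intro u
  simp only [AlgHom.toLinearMap_apply]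
  induction u using Env.induction_on with
  | algebraMap c => simpa using const_mem_holomorphicFamilies _
  | ι X =>
    let e := Module.finBasis ℂ L
    have key : (fun x => P.envAd (γ x) (Env.ι X)) =
        ∑ k, fun x => e.coord k (P.Ad (γ x) X) • Env.ι (e k) := by
      ext x
      rw [envAd_ι, Finset.sum_apply]
      simp only [← map_smul, ← map_sum, Module.Basis.coord_apply, e.sum_repr]
    rw [key]
    exact sum_mem fun k _ =>
      smul_const_mem_holomorphicFamilies ((P.Ad_holomorphic (e.coord k) X).comp hγ) _
  | mul u v hu hv =>
    simpa using bilin_mem_holomorphicFamilies (LinearMap.mul ℂ (Env L)) hu hv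
  | add u v hu hv => simpa [Pi.add_def] using add_mem hu hv

theorem mdifferentiable_mul_comp {α β : M → G} (hα : MDifferentiable I 𝓘(ℂ, F) α)
    (hβ : MDifferentiable I 𝓘(ℂ, F) β) : MDifferentiable I 𝓘(ℂ, F) fun x => α x * β x :=
  ((contMDiff_mul 𝓘(ℂ, F) ω (G := G)).mdifferentiable (by simp)).comp (hα.prodMk hβ)

theorem mdifferentiable_inv_comp {α : M → G} (hα : MDifferentiable I 𝓘(ℂ, F) α) :
    MDifferentiable I 𝓘(ℂ, F) fun x => (α x)⁻¹ :=
  ((contMDiff_inv 𝓘(ℂ, F) ω (G := G)).mdifferentiable (by simp)).comp hα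

variable [FiniteDimensional ℂ L]

theorem isHolomorphicOperator_mulMap (α : M → G) {β : M → G} (hβ : MDifferentiable I 𝓘(ℂ, F) β) :
    IsHolomorphicOperator I fun x => P.mulMap.fibre (α x, β x) :=
  (IsHolomorphicOperator.const _).comp
    ((P.isHolomorphicOperator_envAd (mdifferentiable_inv_comp hβ)).tensorMap
      (IsHolomorphicOperator.const _))

theorem isHolomorphicOperator_invMap {α : M → G} (hα : MDifferentiable I 𝓘(ℂ, F) α) :
    IsHolomorphicOperator I fun x => P.invMap.fibre (α x) :=
  (P.isHolomorphicOperator_envAd hα).comp (IsHolomorphicOperator.const _)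

theorem isHolomorphicOperator_conjMap {α β : M → G} (hα : MDifferentiable I 𝓘(ℂ, F) α)
    (hβ : MDifferentiable I 𝓘(ℂ, F) β) :
    IsHolomorphicOperator I fun x => P.conjMap.fibre (α x, β x) := fun z =>
  (P.isHolomorphicOperator_mulMap (fun x => β x * α x) (mdifferentiable_inv_comp hβ)).apply
    (((P.isHolomorphicOperator_mulMap β hα).tensorMap (P.isHolomorphicOperator_invMap hβ))
      (TensorProduct.map Env.flip LinearMap.id ((TensorProduct.assoc ℂ _ _ _).symm
        (TensorProduct.map LinearMap.id Env.comul z))))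

theorem conjMap_pullback_mem_superfunctions {U : Opens G} {Φ : (U →₀ Env L) →ₗ[ℂ] ℂ}
    (hΦ : Φ ∈ superfunctions 𝓘(ℂ, F) (Env L) U) :
    P.conjMap.pullback U Φ ∈ superfunctions (𝓘(ℂ, F).prod 𝓘(ℂ, F)) (Env L ⊗[ℂ] Env L)
      (Opens.comap P.conjMap.base U) := by
  intro Z
  have hval : MDifferentiable (𝓘(ℂ, F).prod 𝓘(ℂ, F)) (𝓘(ℂ, F).prod 𝓘(ℂ, F))
      (Subtype.val : Opens.comap P.conjMap.base U → G × G) :=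
    (contMDiff_subtype_val (n := ω)).mdifferentiable (by simp)
  have hα := mdifferentiable_fst.comp hval
  have hβ := mdifferentiable_snd.comp hval
  -- A map into the open submanifold `U` is `C^ω` as soon as its composite with `U → G` is.
  have hφ : MDifferentiable (𝓘(ℂ, F).prod 𝓘(ℂ, F)) 𝓘(ℂ, F)
      (fun x : Opens.comap P.conjMap.base U => (⟨P.conjMap.base x, x.2⟩ : U)) := by
    refine ContMDiff.mdifferentiable (n := ∞) ?_ (by simp)
    refine (ContMDiff.subtypeVal_comp_iff U _).mp ?_
    have h1 : ContMDiff (𝓘(ℂ, F).prod 𝓘(ℂ, F)) 𝓘(ℂ, F) ω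
        (fun p : G × G => p.2 * p.1 * p.2⁻¹) :=
      (contMDiff_snd.mul contMDiff_fst).mul contMDiff_snd.inv
    exact (h1.comp contMDiff_subtype_val).of_le le_top
  have h := mdifferentiable_apply_single hΦ hφ (P.isHolomorphicOperator_conjMap hα hβ Z)
  convert h using 2 with x
  simp only [SuperMap.pullback, SuperMap.pushOn, LinearMap.lcomp_apply, Finsupp.lsum_single]
  rfl

end Holomorphic

end HarishChandraSuperpair

theorem mainTheorem4 {F G L : Type*} [NormedAddCommGroup F] [NormedSpace ℂ F]
    [FiniteDimensional ℂ F] [TopologicalSpace G] [ChartedSpace F G] [Group G]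
    [LieGroup 𝓘(ℂ, F) ω G] [AddCommGroup L] [Module ℂ L] [FiniteDimensional ℂ L]
    [LieSuperalgebra L] (P : HarishChandraSuperpair F G L) :
    (∀ a b : G, P.conjMap.base (a, b) = b * a * b⁻¹) ∧
    (∀ (U : Opens G), ∀ Φ ∈ superfunctions 𝓘(ℂ, F) (LieSuperalgebra.Env L) U,
      P.conjMap.pullback U Φ ∈ superfunctions (𝓘(ℂ, F).prod 𝓘(ℂ, F))
        (LieSuperalgebra.Env L ⊗[ℂ] LieSuperalgebra.Env L) (Opens.comap P.conjMap.base U)) ∧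
    (∀ (a b : G) (i j : ZMod 2) (Xa : LieSuperalgebra.Env L) (Xb : L),
      Xa ∈ LieSuperalgebra.Env.deg (L := L) i → Xb ∈ LieSuperalgebra.grade (L := L) j →
      P.conjMap.push (Finsupp.single (a, b) (Xa ⊗ₜ LieSuperalgebra.Env.ι Xb)) =
        Finsupp.single (b * a * b⁻¹)
          (P.envAd b ((-1 : ℤˣ) ^ (i * j) • (P.envAd a⁻¹ (LieSuperalgebra.Env.ι Xb) * Xa)
            - Xa * LieSuperalgebra.Env.ι Xb))) ∧
    (∀ (a b : G) (Xa : LieSuperalgebra.Env L),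
      P.conjMap.push (Finsupp.single (a, b) (Xa ⊗ₜ 1)) =
        Finsupp.single (b * a * b⁻¹) (P.envAd b Xa)) ∧
    (∀ (a b : G) (Xb : L),
      P.conjMap.push (Finsupp.single (a, b) (1 ⊗ₜ LieSuperalgebra.Env.ι Xb)) =
        Finsupp.single (b * a * b⁻¹) (P.envAd b
          (P.envAd a⁻¹ (LieSuperalgebra.Env.ι Xb) - LieSuperalgebra.Env.ι Xb))) ∧
    (∀ a b : G,
      P.conjMap.push (Finsupp.single (a, b) (1 ⊗ₜ 1)) = Finsupp.single (b * a * b⁻¹) 1) := by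
  refine ⟨fun _ _ => rfl, fun U Φ hΦ => P.conjMap_pullback_mem_superfunctions hΦ, ?_, ?_, ?_, ?_⟩
  · intro a b i j Xa Xb ha hb
    rw [P.push_conjMap_single, P.conjMap_fibre_tmul_ι a b ha hb]
  · intro a b Xa
    rw [P.push_conjMap_single, P.conjMap_fibre_tmul_one]
  · intro a b Xb
    rw [P.push_conjMap_single]
    congr 1
    induction Xb using LieSuperalgebra.homogeneous_induction with
    | mem j X hX =>
      rw [P.conjMap_fibre_tmul_ι a b (i := 0) SetLike.GradedOne.one_mem hX]
      simp
    | zero => simp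
    | add X Y hX hY =>
      simp only [map_add, TensorProduct.tmul_add, map_sub] at hX hY ⊢
      rw [hX, hY]
      abel
  · intro a b
    rw [P.push_conjMap_single, P.conjMap_fibre_tmul_one, map_one]
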